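/- Let $A$ be a unital separable C$^*$-algebra of stable rank one, i.e. the invertible elements are dense in $A$. Let $M_\infty(A)=\bigcup_n M_n(A)$, where $M_n(A)$ is embedded in $M_{n+1}(A)$ by $a\mapsto a\oplus 0$. For positive $a,b\in M_\infty(A)$ write $a\precsim b$ if there is a sequence $(v_k)$ in $M_\infty(A)$ with $\|v_kbv_k^*-a\|\to 0$, and write $a\sim b$ if $a\precsim b$ and $b\precsim a$. Let $W(A)=M_\infty(A)_+/\!\sim$ be the Cuntz semigroup, with classes denoted $\langle a\rangle$ and the partial order $\langle a\rangle\le\langle b\rangle\Leftrightarrow a\precsim b$. For a tracial state $\tau$ on $A$, extended to $M_n(A)$ by $\tau((a_{ij}))=\sum_i\tau(a_{ii})$, put $d_\tau(a)=\lim_{n\to\infty}\tau(a^{1/n})$ for $a\in M_\infty(A)_+$. Let $a_1,a_2,\dots\in M_\infty(A)_+$ be such that $\langle a_1\rangle\le\langle a_2\rangle\le\cdots$ and such that the sequence $(\langle a_n\rangle)$ is bounded above in $W(A)$. Then $(\langle a_n\rangle)$ has a supremum (least upper bound) $\langle a_\infty\rangle$ in $W(A)$. Moreover, for every positive $a_\infty\in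 M_\infty(A)$ whose class is this supremum and for every tracial state $\tau$ on $A$, \[ d_\tau(a_\infty)=\sup_n d_\tau(a_n). \] -/

import Mathlib

open Filter Topology
open scoped ComplexOrder

namespace CuntzSemigroup

section Powers
variable {B : Type*} [CStarAlgebra B] [PartialOrder B] [StarOrderedRing B]
/-- The `n`-th root `a^{1/n}` of a positive element of a unital C⋆-algebra, by functional calculus. -/
noncomputable def root (a : B) (n : ℕ) : B := a ^ (1 / (n : ℝ))

/-- The limit that defines `d_τ` exists. -/
theorem exists_tendsto_root (f : B →ₗ[ℂ] ℂ) (hf : ∀ a, 0 ≤ a → 0 ≤ f a) (a : B) :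
    ∃ l : ℝ, Tendsto (fun n : ℕ => (f (root a n)).re) atTop (𝓝 l) := by
  set c : NNReal := ‖a‖₊ * ‖(1 : B)‖₊ + 1 with hc
  have hc0 : 0 < c := by positivity
  have hsp : ∀ t ∈ spectrum NNReal a, t / c ≤ 1 := fun t ht => by
    have h := spectrum.norm_le_norm_mul_of_mem (spectrum.algebraMap_mem ℝ ht)
    have h' : t ≤ ‖a‖₊ * ‖(1 : B)‖₊ := by
      rw [← NNReal.coe_le_coe]
      simpa using h
    exact div_le_one_of_le₀ (h'.trans (by simp [hc])) hc0.le
  have hcont : ∀ n : ℕ, Continuous fun t : NNReal => (t / c) ^ (1 / ((n : ℝ) + 1)) := fun n =>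
    (NNReal.continuous_rpow_const (by positivity)).comp (continuous_id.div_const c)
  let g : ℕ → B := fun n => cfc (fun t : NNReal => (t / c) ^ (1 / ((n : ℝ) + 1))) a
  have hre : ∀ x y : B, x ≤ y → (f x).re ≤ (f y).re := fun x y h => by
    have h1 := (Complex.le_def.1 (hf _ (sub_nonneg.2 h))).1
    rw [map_sub] at h1
    simpa using h1
  have hmono : Monotone g := fun n m hnm => by
    refine cfc_mono (fun t ht => ?_) (hcont n).continuousOn (hcont m).continuousOn
    have : 1 / ((m : ℝ) + 1) ≤ 1 / ((n : ℝ) + 1) := by gcongr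
    rw [← NNReal.coe_le_coe]
    exact Real.rpow_le_rpow_of_exponent_ge' (t / c).2 (hsp t ht) (by positivity) this
  have hle : ∀ n, g n ≤ 1 := fun n => by
    refine (cfc_le_one (R := NNReal) _ a) fun t ht => ?_
    exact NNReal.rpow_le_one (hsp t ht) (by positivity)
  have hlim := tendsto_atTop_ciSup (f := fun n => (f (g n)).re)
    (fun n m h => hre _ _ (hmono h)) ⟨(f 1).re, by rintro _ ⟨n, rfl⟩; exact hre _ _ (hle n)⟩
  have hroot : ∀ n : ℕ, root a (n + 1) = (c ^ (1 / ((n : ℝ) + 1))) • g n := fun n => by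
    rw [← cfc_const_mul _ _ a (hcont n).continuousOn, root, CFC.rpow_def]
    push_cast
    refine cfc_congr fun t _ => ?_
    rw [← NNReal.mul_rpow, mul_div_cancel₀ _ hc0.ne']
  have hcl : Tendsto (fun n : ℕ => (c : ℝ) ^ (1 / ((n : ℝ) + 1))) atTop (𝓝 1) := by
    have := (Real.continuous_const_rpow (a := (c : ℝ)) (by positivity)).tendsto 0
    rw [Real.rpow_zero] at this
    exact this.comp tendsto_one_div_add_atTop_nhds_zero_nat
  refine ⟨_, (tendsto_add_atTop_iff_nat 1).1 ((hcl.mul hlim).congr fun n => ?_)⟩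
  rw [hroot, NNReal.smul_def, ← Complex.coe_smul, map_smul]
  simp
end Powers

section Matrices

set_option linter.unusedSectionVars false

variable {A : Type*} [CStarAlgebra A] [PartialOrder A] [StarOrderedRing A]

/-- Put the `n × m` matrix `a` in the upper left corner of an `N × N` matrix and fill up with
zeros. For `m = n ≤ N` this is the connecting map `M_n(A) → M_N(A)`, `a ↦ a ⊕ 0`, of the direct
system with algebraic limit `M_∞(A)`. -/
def pad {n m : ℕ} (N : ℕ) (a : CStarMatrix (Fin n) (Fin m) A) : CStarMatrix (Fin N) (Fin N) A :=
  CStarMatrix.ofMatrix fun i j =>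
    if h : i.1 < n ∧ j.1 < m then a ⟨i.1, h.1⟩ ⟨j.1, h.2⟩ else 0

theorem pad_apply {n m : ℕ} (N : ℕ) (a : CStarMatrix (Fin n) (Fin m) A) (i j : Fin N) :
    pad N a i j = if h : i.1 < n ∧ j.1 < m then a ⟨i.1, h.1⟩ ⟨j.1, h.2⟩ else 0 := rfl

variable (A) in
/-- A positive element of `M_∞(A) = ⋃ₙ M_n(A)`, given by a positive matrix in some `M_n(A)`.
The matrices `a` and `a ⊕ 0`, which are the same element of `M_∞(A)`, become equal
in the Cuntz semigroup `W A` below. -/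
structure MInftyPos where
  /-- the size of the matrix -/
  size : ℕ
  /-- the matrix -/
  mat : CStarMatrix (Fin size) (Fin size) A
  nonneg : 0 ≤ mat

/-- Cuntz subequivalence `a ≾ b`: there is a sequence `(v k)` in `M_∞(A)` such that
`‖v k * b * (v k)⋆ - a‖ → 0`. The `k`-th term is computed in `M_{N k}(A)` for some `N k` that is
large enough for `v k`, `a` and `b`. -/
def CuntzSubequiv (a b : MInftyPos A) : Prop :=
  ∃ (N : ℕ → ℕ) (v : ∀ k, CStarMatrix (Fin (N k)) (Fin (N k)) A),
    (∀ k, a.size ≤ N k ∧ b.size ≤ N k) ∧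
    Tendsto (fun k => ‖v k * pad (N k) b.mat * star (v k) - pad (N k) a.mat‖) atTop (𝓝 0)

theorem sum_castLE {m N : ℕ} (h : m ≤ N) (f : Fin N → A) (hf : ∀ p, m ≤ p.1 → f p = 0) :
    ∑ p, f p = ∑ p : Fin m, f (Fin.castLE h p) := by
  obtain ⟨d, rfl⟩ := Nat.exists_eq_add_of_le h
  rw [Fin.sum_univ_add, Finset.sum_eq_zero (s := (Finset.univ : Finset (Fin d))), add_zero]
  · rfl
  · intro p _
    exact hf _ (by simp)

theorem pad_mul_pad {n l m N : ℕ} (hl : l ≤ N) (a : CStarMatrix (Fin n) (Fin l) A)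
    (b : CStarMatrix (Fin l) (Fin m) A) : pad N a * pad N b = pad N (a * b) := by
  ext i j
  rw [CStarMatrix.mul_apply, sum_castLE hl]
  · by_cases hi : i.1 < n <;> by_cases hj : j.1 < m <;>
      simp [pad_apply, hi, hj, CStarMatrix.mul_apply]
  · intro p hp
    simp [pad_apply, not_lt.2 hp]

theorem star_pad {n m N : ℕ} (a : CStarMatrix (Fin n) (Fin m) A) :
    star (pad N a) = pad N a.conjTranspose := by
  ext i j
  by_cases hi : i.1 < m <;> by_cases hj : j.1 < n <;>
    simp [pad_apply, hi, hj, CStarMatrix.star_apply, CStarMatrix.conjTranspose_apply]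

theorem pad_sub {n m N : ℕ} (a b : CStarMatrix (Fin n) (Fin m) A) :
    pad N a - pad N b = pad N (a - b) := by
  ext i j
  by_cases hi : i.1 < n <;> by_cases hj : j.1 < m <;> simp [pad_apply, hi, hj]

theorem tendsto_iff_entries {ι : Type*} {l : Filter ι} {n m : ℕ}
    {f : ι → CStarMatrix (Fin n) (Fin m) A} {a : CStarMatrix (Fin n) (Fin m) A} :
    Tendsto f l (𝓝 a) ↔ ∀ i j, Tendsto (fun k => f k i j) l (𝓝 (a i j)) := by
  refine (tendsto_pi_nhds (f := fun k i => f k i)).trans ?_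
  exact forall_congr' fun i => tendsto_pi_nhds

/-- The sequence in the definition of `≾` may be taken to consist of rectangular matrices. -/
theorem cuntzSubequiv_iff {a b : MInftyPos A} :
    CuntzSubequiv a b ↔ ∃ v : ℕ → CStarMatrix (Fin a.size) (Fin b.size) A,
      Tendsto (fun k => v k * b.mat * (v k).conjTranspose) atTop (𝓝 a.mat) := by
  constructor
  · rintro ⟨N, v, hN, h⟩
    let w : ∀ k, CStarMatrix (Fin a.size) (Fin b.size) A := fun k => CStarMatrix.ofMatrix fun i j =>
      v k (Fin.castLE (hN k).1 i) (Fin.castLE (hN k).2 j)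
    have hw : ∀ k i j, w k i j = v k (Fin.castLE (hN k).1 i) (Fin.castLE (hN k).2 j) :=
      fun _ _ _ => rfl
    refine ⟨w, ?_⟩
    rw [tendsto_iff_entries]
    intro i j
    rw [tendsto_iff_norm_sub_tendsto_zero]
    refine squeeze_zero (fun _ => norm_nonneg _) (fun k => ?_) h
    refine le_of_eq_of_le ?_ (CStarMatrix.norm_entry_le_norm
      (i := Fin.castLE (hN k).1 i) (j := Fin.castLE (hN k).1 j))
    congr 1
    rw [CStarMatrix.sub_apply, CStarMatrix.mul_apply, CStarMatrix.mul_apply,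
      sum_castLE (hN k).2]
    · congr 1
      · refine Finset.sum_congr rfl fun q _ => ?_
        rw [CStarMatrix.mul_apply, CStarMatrix.mul_apply, sum_castLE (hN k).2]
        · simp [pad_apply, hw, CStarMatrix.star_apply, CStarMatrix.conjTranspose_apply]
        · intro p hp
          simp [pad_apply, not_lt.2 hp]
      · simp [pad_apply]
    · intro q hq
      rw [CStarMatrix.mul_apply, Finset.sum_eq_zero, zero_mul]
      intro p _
      simp [pad_apply, not_lt.2 hq]
  · rintro ⟨v, hv⟩
    refine ⟨fun _ => max a.size b.size, fun k => pad _ (v k),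
      fun _ => ⟨le_max_left _ _, le_max_right _ _⟩, ?_⟩
    simp only [star_pad, pad_mul_pad (le_max_right a.size b.size), pad_sub]
    rw [← tendsto_zero_iff_norm_tendsto_zero, tendsto_iff_entries]
    rw [tendsto_iff_entries] at hv
    intro i j
    by_cases h : i.1 < a.size ∧ j.1 < a.size
    · simpa [pad_apply, h] using (hv ⟨i, h.1⟩ ⟨j, h.2⟩).sub_const (a.mat ⟨i, h.1⟩ ⟨j, h.2⟩)
    · simp [pad_apply, h]

theorem cuntzSubequiv_iff_mem_closure {a b : MInftyPos A} :
    CuntzSubequiv a b ↔ a.mat ∈ closure (Set.range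
      fun v : CStarMatrix (Fin a.size) (Fin b.size) A => v * b.mat * v.conjTranspose) := by
  rw [cuntzSubequiv_iff, mem_closure_iff_seq_limit]
  constructor
  · rintro ⟨v, hv⟩
    exact ⟨_, fun k => ⟨v k, rfl⟩, hv⟩
  · rintro ⟨x, hx, hl⟩
    choose v hv using hx
    exact ⟨v, by simpa only [hv] using hl⟩

theorem CuntzSubequiv.refl (a : MInftyPos A) : CuntzSubequiv a a := by
  refine cuntzSubequiv_iff.2 ⟨fun _ => 1, ?_⟩
  have h : (1 : CStarMatrix (Fin a.size) (Fin a.size) A) * a.mat *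
      CStarMatrix.conjTranspose 1 = a.mat := by
    rw [← CStarMatrix.star_eq_conjTranspose, star_one, one_mul, mul_one]
  exact (tendsto_const_nhds (x := a.mat)).congr fun _ => h.symm

theorem CuntzSubequiv.trans {a b c : MInftyPos A} (hab : CuntzSubequiv a b)
    (hbc : CuntzSubequiv b c) : CuntzSubequiv a c := by
  rw [cuntzSubequiv_iff_mem_closure] at *
  refine closure_minimal ?_ isClosed_closure hab
  rintro _ ⟨v, rfl⟩
  have hc : Continuous fun x : CStarMatrix (Fin b.size) (Fin b.size) A =>
      v * x * v.conjTranspose :=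
    (Continuous.matrix_mul (A := fun _ => v) continuous_const continuous_id).matrix_mul
      (B := fun _ => v.conjTranspose) continuous_const
  refine map_mem_closure (f := fun x => v * x * v.conjTranspose) hc hbc ?_
  rintro _ ⟨w, rfl⟩
  refine ⟨v * w, ?_⟩
  have h : ∀ (n l m : ℕ) (v : Matrix (Fin n) (Fin l) A) (w : Matrix (Fin l) (Fin m) A)
      (x : Matrix (Fin m) (Fin m) A),
      v * w * x * (v * w).conjTranspose = v * (w * x * w.conjTranspose) * v.conjTranspose := by
    intro n l m v w x
    simp only [Matrix.conjTranspose_mul, Matrix.mul_assoc]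
  exact h _ _ _ v w c.mat

instance : Preorder (MInftyPos A) where
  le := CuntzSubequiv
  le_refl := CuntzSubequiv.refl
  le_trans _ _ _ := CuntzSubequiv.trans

variable (A) in
/-- The Cuntz semigroup `W(A) = M_∞(A)₊ / ∼` where `a ∼ b` means `a ≾ b` and `b ≾ a`, with the
partial order `⟨a⟩ ≤ ⟨b⟩ ↔ a ≾ b`. -/
abbrev W : Type _ := Antisymmetrization (MInftyPos A) (· ≤ ·)

/-- The class `⟨a⟩` in `W(A)`. -/
def cls (a : MInftyPos A) : W A := toAntisymmetrization (· ≤ ·) a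

theorem cls_le_cls {a b : MInftyPos A} : cls a ≤ cls b ↔ CuntzSubequiv a b := Iff.rfl

variable (A) in
/-- A tracial state on `A`. -/
structure TracialState extends A →ₚ[ℂ] ℂ where
  map_one : toFun 1 = 1
  map_mul_comm : ∀ a b, toFun (a * b) = toFun (b * a)

/-- The (unnormalised) extension `a ↦ ∑ i, τ (a i i)` of `τ` to `M_n(A)`. -/
noncomputable def TracialState.trace (τ : TracialState A) (n : ℕ) :
    CStarMatrix (Fin n) (Fin n) A →ₗ[ℂ] ℂ where
  toFun a := ∑ i, τ.toPositiveLinearMap (a i i)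
  map_add' a b := by simp [Finset.sum_add_distrib]
  map_smul' c a := by simp [Finset.mul_sum]

/-- `d_τ(a) = lim_n τ(a^{1/n})`; the limit exists by `tendsto_dimFun`. -/
noncomputable def dimFun (τ : TracialState A) (a : MInftyPos A) : ℝ :=
  limUnder atTop fun n : ℕ => (τ.trace a.size (root a.mat n)).re

theorem TracialState.trace_nonneg (τ : TracialState A) {n : ℕ}
    (a : CStarMatrix (Fin n) (Fin n) A) (ha : 0 ≤ a) : 0 ≤ τ.trace n a := by
  have key : ∀ {B : Type _} [CStarAlgebra B] [PartialOrder B] [StarOrderedRing B] (b : B),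
      0 ≤ b → ∃ x, b = star x * x := fun b hb => CStarAlgebra.nonneg_iff_eq_star_mul_self.1 hb
  obtain ⟨x, rfl⟩ := key a ha
  refine Finset.sum_nonneg fun i _ => τ.toPositiveLinearMap.map_nonneg ?_
  rw [CStarMatrix.mul_apply]
  exact Finset.sum_nonneg fun j _ => by
    rw [CStarMatrix.star_apply]; exact star_mul_self_nonneg _

/-- The limit in the definition of `d_τ` always exists. -/
theorem tendsto_dimFun (τ : TracialState A) (a : MInftyPos A) :
    Tendsto (fun n : ℕ => (τ.trace a.size (root a.mat n)).re) atTop (𝓝 (dimFun τ a)) :=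
  tendsto_nhds_limUnder (exists_tendsto_root _ τ.trace_nonneg _)

end Matrices

end CuntzSemigroup

namespace CuntzSemigroup

/-! ### Resolvent approximate units and polar parts in a C⋆-algebra. -/

section Generic
variable {B : Type*} [CStarAlgebra B] [PartialOrder B] [StarOrderedRing B]

/-! The supremum comes from Baire category. Let `b ∈ M_n(A)` bound the sequence, and let `S` be the
closure in `M_n(A)` of the positive elements below some `a j`. Every element of `S` lies below every
upper bound, since `{x | Dom x c}` is closed. So it suffices to find `s ∈ S` above all `a j`. Being
above `a j` up to `1/(N+1)` is an open condition on `S`; if it is also dense, Baire gives such an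
`s` (`exists_dom_limit`).

Density is where stable rank one enters (`mem_closure_approxEquiv`). Given `d ≈ u a u⋆` with `a ≾
b`, approximate `a` by `x x⋆` with `x` having `n` columns. Then `m = u x` is square, and `m m⋆` is a
limit of isometric conjugates of `m⋆ m = x⋆(u⋆u)x`. Adding a small scalar to `u⋆u` makes the middle
factor invertible, and the result is Cuntz equivalent to `x x⋆`, hence dominates `a` up to `ε`.

For traces, `d_τ(a)` is the supremum over `δ` of `τ(a(a+δ)⁻¹)` (`isLUB_dimFun`). This makes `d_τ`
monotone for `≾` and lower semicontinuous, so a limit of elements below the `a j` cannot exceed `sup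
d_τ(a j)`. -/

theorem isStrictlyPositive_add_algebraMap {a : B} (ha : 0 ≤ a) {δ : ℝ} (hδ : 0 < δ) :
    IsStrictlyPositive (a + algebraMap ℝ B δ) := by
  have h : IsStrictlyPositive (algebraMap ℝ B δ) :=
    ⟨algebraMap_nonneg B hδ.le, (IsUnit.mk0 δ hδ.ne').map (algebraMap ℝ B)⟩
  exact h.nonneg_add ha

/-- The resolvent-type approximate unit `a (a + δ)⁻¹`. -/
noncomputable def approxUnit (δ : ℝ) (a : B) : B := a * Ring.inverse (a + algebraMap ℝ B δ)

variable {a b : B} {δ : ℝ}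

theorem approxUnit_eq (ha : 0 ≤ a) (hδ : 0 < δ) :
    approxUnit δ a = 1 - δ • Ring.inverse (a + algebraMap ℝ B δ) := by
  have h := Ring.mul_inverse_cancel _ (isStrictlyPositive_add_algebraMap ha hδ).isUnit
  rw [add_mul, Algebra.algebraMap_eq_smul_one, smul_mul_assoc, one_mul] at h
  rw [approxUnit, Algebra.algebraMap_eq_smul_one]
  exact eq_sub_of_add_eq h

theorem approxUnit_le_one (ha : 0 ≤ a) (hδ : 0 < δ) : approxUnit δ a ≤ 1 := by
  rw [approxUnit_eq ha hδ, sub_le_self_iff]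
  exact smul_nonneg hδ.le (isStrictlyPositive_add_algebraMap ha hδ).ringInverse.nonneg

theorem approxUnit_mono (ha : 0 ≤ a) (hab : a ≤ b) (hδ : 0 < δ) :
    approxUnit δ a ≤ approxUnit δ b := by
  rw [approxUnit_eq ha hδ, approxUnit_eq (ha.trans hab) hδ]
  have h := isStrictlyPositive_add_algebraMap ha hδ
  gcongr

theorem approxUnit_nonneg (ha : 0 ≤ a) (hδ : 0 < δ) : 0 ≤ approxUnit δ a := by
  simpa [approxUnit] using approxUnit_mono le_rfl ha hδ

theorem continuousAt_approxUnit (ha : 0 ≤ a) (hδ : 0 < δ) :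
    ContinuousAt (approxUnit δ) a := by
  obtain ⟨u, hu⟩ := (isStrictlyPositive_add_algebraMap ha hδ).isUnit
  have h := NormedRing.inverse_continuousAt u
  rw [hu] at h
  have h' : ContinuousAt (fun x : B => x + algebraMap ℝ B δ) a := by fun_prop
  exact continuousAt_id.mul (ContinuousAt.comp (f := fun x : B => x + algebraMap ℝ B δ) h h')

theorem mul_approxUnit_comm (ha : 0 ≤ a) (hδ : 0 < δ) :
    a * (1 - approxUnit δ a) = δ • approxUnit δ a := by
  rw [approxUnit_eq ha hδ, sub_sub_cancel, mul_smul_comm, ← approxUnit_eq ha hδ, approxUnit]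

/-- With `p = s⋆s` and `e` its approximate unit, `(s - se)⋆(s - se) = (1 - e)p(1 - e) = δ(1 - e)e`,
and both remaining factors are contractions. -/
theorem norm_sub_mul_approxUnit_sq_le {s : B} (hδ : 0 < δ) :
    ‖s - s * approxUnit δ (star s * s)‖ ^ 2 ≤ δ := by
  set p := star s * s with hp
  have hp0 : 0 ≤ p := star_mul_self_nonneg s
  set e := approxUnit δ p with he
  have he0 : 0 ≤ e := approxUnit_nonneg hp0 hδ
  have he1 : e ≤ 1 := approxUnit_le_one hp0 hδ
  have h1 : star (s - s * e) * (s - s * e) = δ • ((1 - e) * e) := by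
    rw [show s - s * e = s * (1 - e) by rw [mul_sub, mul_one], star_mul,
      (sub_nonneg.2 he1).isSelfAdjoint.star_eq, mul_assoc, ← mul_assoc (star s), ← hp,
      mul_approxUnit_comm hp0 hδ, mul_smul_comm]
  have h2 : ‖e‖ ≤ 1 := (CStarAlgebra.norm_le_one_iff_of_nonneg e he0).2 he1
  have h3 : ‖1 - e‖ ≤ 1 :=
    (CStarAlgebra.norm_le_one_iff_of_nonneg _ (sub_nonneg.2 he1)).2 (sub_le_self _ he0)
  rw [sq, ← CStarRing.norm_star_mul_self, h1, norm_smul, Real.norm_of_nonneg hδ.le]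
  calc δ * ‖(1 - e) * e‖ ≤ δ * (1 * 1) := by
        gcongr
        exact (norm_mul_le _ _).trans (mul_le_mul h3 h2 (norm_nonneg _) zero_le_one)
    _ = δ := by ring

theorem tendsto_mul_approxUnit (s : B) :
    Tendsto (fun δ => s * approxUnit δ (star s * s)) (𝓝[>] 0) (𝓝 s) := by
  rw [tendsto_iff_norm_sub_tendsto_zero]
  have h : Tendsto (fun δ : ℝ => √δ) (𝓝[>] 0) (𝓝 0) := by
    have := (Real.continuous_sqrt.tendsto 0).mono_left (nhdsWithin_le_nhds (s := Set.Ioi 0))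
    rwa [Real.sqrt_zero] at this
  refine squeeze_zero' (.of_forall fun _ => norm_nonneg _) ?_ h
  filter_upwards [self_mem_nhdsWithin] with δ hδ
  rw [norm_sub_rev]
  exact Real.le_sqrt_of_sq_le (norm_sub_mul_approxUnit_sq_le hδ)

theorem exists_sqrt_of_nonneg (ha : 0 ≤ a) : ∃ h : B, star h = h ∧ h * h = a :=
  ⟨CFC.sqrt a, (CFC.sqrt_nonneg a).isSelfAdjoint.star_eq, CFC.sqrt_mul_sqrt_self a ha⟩

theorem exists_sqrt_of_isStrictlyPositive (ha : IsStrictlyPositive a) :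
    ∃ h g : B, star h = h ∧ h * h = a ∧ g * h = 1 :=
  ⟨CFC.sqrt a, Ring.inverse (CFC.sqrt a), (CFC.sqrt_nonneg a).isSelfAdjoint.star_eq,
    CFC.sqrt_mul_sqrt_self a ha.nonneg, Ring.inverse_mul_cancel _ ha.isUnit_cfcSqrt⟩

theorem star_inverse_add_algebraMap (ha : 0 ≤ a) (hδ : 0 < δ) :
    star (Ring.inverse (a + algebraMap ℝ B δ)) = Ring.inverse (a + algebraMap ℝ B δ) :=
  (isStrictlyPositive_add_algebraMap ha hδ).ringInverse.nonneg.isSelfAdjoint.star_eq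

theorem star_approxUnit (ha : 0 ≤ a) (hδ : 0 < δ) :
    star (approxUnit δ a) = approxUnit δ a :=
  (approxUnit_nonneg ha hδ).isSelfAdjoint.star_eq

theorem approxUnit_smul (ha : 0 ≤ a) (hδ : 0 < δ) {C : ℝ} (hC : 0 < C) :
    approxUnit δ (C • a) = approxUnit (δ / C) a := by
  have hu := (isStrictlyPositive_add_algebraMap ha (div_pos hδ hC)).isUnit
  have h : C • a + algebraMap ℝ B δ = C • (a + algebraMap ℝ B (δ / C)) := by
    rw [smul_add, Algebra.algebraMap_eq_smul_one, Algebra.algebraMap_eq_smul_one, smul_smul,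
      mul_div_cancel₀ _ hC.ne']
  have hw := (isStrictlyPositive_add_algebraMap (smul_nonneg hC.le ha) hδ).isUnit
  refine ((Ring.eq_mul_inverse_iff_mul_eq _ _ _ hw).2 ?_).symm
  rw [h, approxUnit, mul_smul_comm, mul_assoc, Ring.inverse_mul_cancel _ hu, mul_one]

/-- From `y ≤ C` follows `cyc ≤ C b`; monotonicity of `approxUnit δ` then applies, and the scalar is
absorbed into `δ`. Taking `C = ‖y‖ + 1` keeps it positive when `y = 0`. -/
theorem exists_approxUnit_conj_le {c : B} (hc : star c = c) (hcb : c * c = b) {y : B}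
    (hy : 0 ≤ y) :
    ∃ C : ℝ, 0 < C ∧ ∀ δ, 0 < δ → approxUnit δ (c * y * c) ≤ approxUnit (δ / C) b := by
  have hC : 0 < ‖y‖ + 1 := by positivity
  have h1 : y ≤ algebraMap ℝ B (‖y‖ + 1) :=
    (IsSelfAdjoint.le_algebraMap_norm_self hy.isSelfAdjoint).trans
      (algebraMap_mono B (by simp))
  have h2 := star_left_conjugate_le_conjugate h1 c
  have h3 := star_left_conjugate_nonneg hy c
  rw [hc] at h3
  rw [hc, Algebra.algebraMap_eq_smul_one, mul_smul_comm, smul_mul_assoc, mul_one, hcb] at h2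
  have hb : 0 ≤ b := by
    rw [← hcb]
    nth_rewrite 1 [← hc]
    exact star_mul_self_nonneg c
  refine ⟨‖y‖ + 1, hC, fun δ hδ => ?_⟩
  rw [← approxUnit_smul hb hδ hC]
  exact approxUnit_mono h3 h2 hδ

/-- An invertible element has an isometric polar part, which conjugates `m⋆m` to `mm⋆`. -/
theorem exists_isometry_conj_of_isUnit {m : B} (hm : IsUnit m) :
    ∃ w : B, star w * w = 1 ∧ w * (star m * m) * star w = m * star m := by
  have hp : IsStrictlyPositive (star m * m) :=
    ⟨star_mul_self_nonneg m, hm.star.mul hm⟩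
  obtain ⟨h, hh, hsa, he⟩ : ∃ b : B, IsUnit b ∧ IsSelfAdjoint b ∧ star m * m = b * b :=
    ⟨CFC.sqrt (star m * m), hp.isUnit_cfcSqrt, (CFC.sqrt_nonneg _).isSelfAdjoint,
      (CFC.sqrt_mul_sqrt_self _ hp.nonneg).symm⟩
  obtain ⟨u, rfl⟩ := hh
  have hs : star (↑u⁻¹ : B) = ↑u⁻¹ := by
    rw [← Units.coe_star_inv]
    have : star u = u := Units.ext hsa.star_eq
    rw [this]
  refine ⟨m * ↑u⁻¹, ?_, ?_⟩
  · rw [star_mul, hs, mul_assoc, ← mul_assoc (star m), he]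
    simp [mul_assoc]
  · rw [star_mul, hs, he]
    simp [mul_assoc]

/-- Use the polar part `w` of an invertible `x` near `m`. There is no control on how `w` varies with
`x`, but `‖w‖ ≤ 1` bounds the error by the distances from `x⋆x` to `m⋆m` and from `xx⋆` to `mm⋆`. -/
theorem mul_star_mem_closure_conj (hsr : Dense {x : B | IsUnit x}) (m : B) :
    m * star m ∈ closure {y | ∃ w : B, star w * w = 1 ∧ y = w * (star m * m) * star w} := by
  rw [Metric.mem_closure_iff]
  intro ε hε
  have hc : Tendsto (fun x : B => ‖x * star x - m * star m‖ + ‖star x * x - star m * m‖)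
      (𝓝 m) (𝓝 0) := by
    have : Continuous fun x : B =>
        ‖x * star x - m * star m‖ + ‖star x * x - star m * m‖ := by fun_prop
    simpa using this.tendsto m
  obtain ⟨x, hx, hxu⟩ := mem_closure_iff_nhds.1 (hsr m) _ (hc.eventually (gt_mem_nhds hε))
  obtain ⟨w, hw, hwx⟩ := exists_isometry_conj_of_isUnit hxu
  refine ⟨_, ⟨w, hw, rfl⟩, ?_⟩
  have hw1 : ‖w‖ ≤ 1 := by
    have h1 : ‖(1 : B)‖ ≤ 1 := (CStarAlgebra.norm_le_one_iff_of_nonneg 1).2 le_rfl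
    have : ‖w‖ * ‖w‖ ≤ 1 := by rw [← CStarRing.norm_star_mul_self, hw]; exact h1
    nlinarith [norm_nonneg w]
  have h2 : ‖w * (star x * x - star m * m) * star w‖ ≤ ‖star x * x - star m * m‖ := by
    calc _ ≤ ‖w‖ * ‖star x * x - star m * m‖ * ‖star w‖ :=
          (norm_mul_le _ _).trans (by gcongr; exact norm_mul_le _ _)
      _ ≤ 1 * ‖star x * x - star m * m‖ * 1 := by
          rw [norm_star]; gcongr
      _ = _ := by ring
  have h3 : m * star m - w * (star m * m) * star w =
      w * (star x * x - star m * m) * star w - (x * star x - m * star m) := by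
    rw [mul_sub, sub_mul, hwx]; abel
  have hx' : ‖x * star x - m * star m‖ + ‖star x * x - star m * m‖ < ε := hx
  rw [dist_eq_norm, h3]
  calc _ ≤ _ := norm_sub_le _ _
    _ < ε := by linarith

/-! ### Comparison of roots with resolvent approximate units. -/

/-- `a (a + δ)⁻¹` through the functional calculus. -/
theorem approxUnit_eq_cfc (ha : 0 ≤ a) {δ : NNReal} (hδ : 0 < δ) :
    approxUnit (δ : ℝ) a = cfc (fun t : NNReal => t / (t + δ)) a := by
  have hc : Continuous fun t : NNReal => t / (t + δ) :=
    continuous_id.div (by fun_prop) fun t => (add_pos_of_nonneg_of_pos zero_le hδ).ne'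
  have hu := (isStrictlyPositive_add_algebraMap ha (NNReal.coe_pos.2 hδ)).isUnit
  have h1 : a + algebraMap ℝ B δ = cfc (fun t : NNReal => t + δ) a := by
    rw [cfc_add_const δ (fun t : NNReal => t) a, cfc_id' NNReal a]
    rfl
  have h2 : cfc (fun t : NNReal => t / (t + δ)) a * (a + algebraMap ℝ B δ) = a := by
    rw [h1, ← cfc_mul _ _ a hc.continuousOn (by fun_prop)]
    conv_rhs => rw [← cfc_id' NNReal a]
    refine cfc_congr fun t _ => ?_
    exact div_mul_cancel₀ _ (add_pos_of_nonneg_of_pos zero_le hδ).ne'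
  rw [approxUnit]
  exact ((Ring.eq_mul_inverse_iff_mul_eq _ _ _ hu).2 h2).symm

theorem rpow_mul_rpow_one_sub_le (x : NNReal) {y : NNReal} (hy : 0 < y) {p : ℝ} (h0 : 0 ≤ p)
    (h1 : p ≤ 1) : x ^ p * y ^ (1 - p) ≤ x + y := by
  calc x ^ p * y ^ (1 - p) ≤ (x + y) ^ p * (x + y) ^ (1 - p) :=
        mul_le_mul' (NNReal.rpow_le_rpow le_self_add h0)
          (NNReal.rpow_le_rpow le_add_self (sub_nonneg.2 h1))
    _ = x + y := by
        rw [← NNReal.rpow_add (add_pos_of_nonneg_of_pos zero_le hy).ne']; simp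

theorem div_add_le_rpow (t : NNReal) {δ : NNReal} (hδ : 0 < δ) {p : ℝ} (h0 : 0 ≤ p)
    (h1 : p ≤ 1) : t / (t + δ) ≤ (δ ^ p)⁻¹ * t ^ p := by
  have hpos : 0 < t + δ := add_pos_of_nonneg_of_pos zero_le hδ
  rw [div_le_iff₀ hpos, mul_assoc, ← div_eq_inv_mul, le_div_iff₀ (NNReal.rpow_pos hδ)]
  rcases eq_or_ne t 0 with rfl | ht
  · simp
  have h := rpow_mul_rpow_one_sub_le t hδ (p := 1 - p) (by linarith) (by linarith)
  rw [sub_sub_cancel] at h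
  calc t * δ ^ p = t ^ p * (t ^ (1 - p) * δ ^ p) := by
        rw [← mul_assoc, ← NNReal.rpow_add ht]; simp
    _ ≤ _ := by gcongr

theorem rpow_le_mul_div_add (t : NNReal) {C δ : NNReal} (hδ : 0 < δ) (htC : t ≤ C) {p : ℝ}
    (h0 : 0 ≤ p) (h1 : p ≤ 1) : t ^ p ≤ C ^ p * (t / (t + δ)) + δ ^ p := by
  have hpos : 0 < t + δ := add_pos_of_nonneg_of_pos zero_le hδ
  rw [← mul_div_assoc, div_add' _ _ _ hpos.ne', le_div_iff₀ hpos, mul_add]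
  refine add_le_add (by gcongr) ?_
  have h := rpow_mul_rpow_one_sub_le t hδ h0 h1
  calc t ^ p * δ = δ ^ p * (t ^ p * δ ^ (1 - p)) := by
        rw [mul_left_comm, ← NNReal.rpow_add hδ.ne']; simp
    _ ≤ _ := by gcongr

theorem approxUnit_le_smul_root (ha : 0 ≤ a) {δ : NNReal} (hδ : 0 < δ) (n : ℕ) :
    approxUnit (δ : ℝ) a ≤ (δ ^ (1 / ((n + 1 : ℕ) : ℝ)))⁻¹ • root a (n + 1) := by
  have hp1 : 1 / ((n + 1 : ℕ) : ℝ) ≤ 1 := by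
    rw [div_le_one (by positivity)]; exact_mod_cast Nat.le_add_left 1 n
  have hc : Continuous fun t : NNReal => t / (t + δ) :=
    continuous_id.div (by fun_prop) fun t => (add_pos_of_nonneg_of_pos zero_le hδ).ne'
  have hr : Continuous fun t : NNReal => t ^ (1 / ((n + 1 : ℕ) : ℝ)) :=
    NNReal.continuous_rpow_const (by positivity)
  rw [approxUnit_eq_cfc ha hδ, root, CFC.rpow_def, ← cfc_const_mul _ _ a hr.continuousOn]
  exact cfc_mono (fun t _ => div_add_le_rpow t hδ (by positivity) hp1) hc.continuousOn
    (by fun_prop)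

theorem root_le_smul_approxUnit_add (ha : 0 ≤ a) {δ C : NNReal} (hδ : 0 < δ)
    (hC : ∀ t ∈ spectrum NNReal a, t ≤ C) (n : ℕ) :
    root a (n + 1) ≤ C ^ (1 / ((n + 1 : ℕ) : ℝ)) • approxUnit (δ : ℝ) a +
      (δ ^ (1 / ((n + 1 : ℕ) : ℝ))) • (1 : B) := by
  have hp1 : 1 / ((n + 1 : ℕ) : ℝ) ≤ 1 := by
    rw [div_le_one (by positivity)]; exact_mod_cast Nat.le_add_left 1 n
  have hc : Continuous fun t : NNReal => t / (t + δ) :=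
    continuous_id.div (by fun_prop) fun t => (add_pos_of_nonneg_of_pos zero_le hδ).ne'
  have hr : Continuous fun t : NNReal => t ^ (1 / ((n + 1 : ℕ) : ℝ)) :=
    NNReal.continuous_rpow_const (by positivity)
  have hc' : Continuous fun t : NNReal => C ^ (1 / ((n + 1 : ℕ) : ℝ)) * (t / (t + δ)) :=
    continuous_const.mul hc
  rw [approxUnit_eq_cfc ha hδ, root, CFC.rpow_def, ← cfc_const_mul _ _ a hc.continuousOn,
    ← Algebra.algebraMap_eq_smul_one, ← cfc_add_const _ _ a hc'.continuousOn]
  exact cfc_mono (fun t ht => rpow_le_mul_div_add t hδ (hC t ht) (by positivity) hp1)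
    hr.continuousOn (hc'.add continuous_const).continuousOn

theorem exists_spectrum_le {B : Type*} [CStarAlgebra B] (a : B) :
    ∃ C : NNReal, 0 < C ∧ ∀ t ∈ spectrum NNReal a, t ≤ C := by
  refine ⟨‖a‖₊ * ‖(1 : B)‖₊ + 1, by positivity, fun t ht => ?_⟩
  have h := spectrum.norm_le_norm_mul_of_mem (spectrum.algebraMap_mem ℝ ht)
  have h' : t ≤ ‖a‖₊ * ‖(1 : B)‖₊ := by
    rw [← NNReal.coe_le_coe]
    simpa using h
  exact h'.trans (by simp)

/-- The limit defining the dimension function is the supremum of the values of the functional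
on the approximate unit `a (a + δ)⁻¹`. -/
theorem isLUB_of_tendsto_root (f : B →ₗ[ℂ] ℂ) (hf : ∀ a, 0 ≤ a → 0 ≤ f a) (ha : 0 ≤ a) {l : ℝ}
    (hl : Tendsto (fun n : ℕ => (f (root a n)).re) atTop (𝓝 l)) :
    IsLUB ((fun δ : ℝ => (f (approxUnit δ a)).re) '' Set.Ioi 0) l := by
  have hre : ∀ x y : B, x ≤ y → (f x).re ≤ (f y).re := fun x y h => by
    have h1 := (Complex.le_def.1 (hf _ (sub_nonneg.2 h))).1
    rw [map_sub] at h1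
    simpa using h1
  have hsm : ∀ (r : NNReal) (x : B), (f (r • x)).re = r * (f x).re := fun r x => by
    rw [NNReal.smul_def, ← Complex.coe_smul, map_smul]
    simp
  -- The shift avoids `n = 0`, where the exponent `1 / 0` is `0`; afterwards all exponents lie in
  -- `(0, 1]`.
  have hl1 := (tendsto_add_atTop_iff_nat 1).2 hl
  have hpow : ∀ c : NNReal, 0 < c →
      Tendsto (fun n : ℕ => (c : ℝ) ^ (1 / ((n + 1 : ℕ) : ℝ))) atTop (𝓝 1) := fun c hc => by
    have := (Real.continuous_const_rpow (a := (c : ℝ)) (by positivity)).tendsto 0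
    rw [Real.rpow_zero] at this
    refine this.comp ?_
    push_cast
    exact tendsto_one_div_add_atTop_nhds_zero_nat
  constructor
  · rintro _ ⟨δ, hδ, rfl⟩
    lift δ to NNReal using (Set.mem_Ioi.1 hδ).le
    have hδ' : 0 < δ := hδ
    have h : Tendsto (fun n : ℕ => ((δ : ℝ) ^ (1 / ((n + 1 : ℕ) : ℝ)))⁻¹ *
        (f (root a (n + 1))).re) atTop (𝓝 (1⁻¹ * l)) :=
      ((hpow δ hδ').inv₀ one_ne_zero).mul hl1
    rw [inv_one, one_mul] at h
    refine ge_of_tendsto' h fun n => ?_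
    have := hre _ _ (approxUnit_le_smul_root ha hδ' n)
    rw [hsm] at this
    simpa using this
  -- For fixed `n`, letting `δ → 0` removes the term `δ ^ (1/(n+1))`; then `n → ∞` sends `C ^
  -- (1/(n+1))` to `1`.
  · intro D hD
    obtain ⟨C, hC0, hC⟩ := exists_spectrum_le a
    have h := (hpow C hC0).mul_const D
    rw [one_mul] at h
    refine le_of_tendsto_of_tendsto' hl1 h fun n => ?_
    have hp : (0 : ℝ) < 1 / ((n + 1 : ℕ) : ℝ) := by positivity
    have hz : Tendsto (fun δ : NNReal => (C : ℝ) ^ (1 / ((n + 1 : ℕ) : ℝ)) * D +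
        (δ : ℝ) ^ (1 / ((n + 1 : ℕ) : ℝ)) * (f 1).re) (𝓝[>] 0)
        (𝓝 ((C : ℝ) ^ (1 / ((n + 1 : ℕ) : ℝ)) * D)) := by
      have hcont : Continuous fun δ : NNReal => (C : ℝ) ^ (1 / ((n + 1 : ℕ) : ℝ)) * D +
          (δ : ℝ) ^ (1 / ((n + 1 : ℕ) : ℝ)) * (f 1).re := by
        have := (Real.continuous_rpow_const hp.le).comp NNReal.continuous_coe
        exact continuous_const.add (this.mul continuous_const)
      have := (hcont.tendsto 0).mono_left (nhdsWithin_le_nhds (s := Set.Ioi 0))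
      rwa [NNReal.coe_zero, Real.zero_rpow hp.ne', zero_mul, add_zero] at this
    refine ge_of_tendsto hz ?_
    filter_upwards [self_mem_nhdsWithin] with δ hδ
    have hδ' : 0 < δ := hδ
    have h2 := hre _ _ (root_le_smul_approxUnit_add ha hδ' hC n)
    rw [map_add, Complex.add_re, hsm, hsm] at h2
    refine h2.trans ?_
    have h3 : (f (approxUnit (δ : ℝ) a)).re ≤ D := hD ⟨δ, NNReal.coe_pos.2 hδ', rfl⟩
    push_cast
    gcongr

end Generic

/-! ### Density of invertibles in matrix rings. -/

section StableRank

open Matrix in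
/-- Stable rank one passes to matrices. -/
theorem dense_isUnit_matrix {R : Type*} [Ring R] [TopologicalSpace R] [IsTopologicalRing R]
    (h : Dense {x : R | IsUnit x}) : ∀ n : ℕ, Dense {x : Matrix (Fin n) (Fin n) R | IsUnit x}
  | 0 => fun x => subset_closure (isUnit_of_subsingleton x)
  | n + 1 => by
    have ih := dense_isUnit_matrix h n
    have h1 : Dense {x : Matrix (Fin 1) (Fin 1) R | IsUnit x} := by
      intro x
      have hx := h (x 0 0)
      have hc : Continuous fun r : R => (Matrix.scalar (Fin 1) r) := by
        refine continuous_matrix fun i j => ?_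
        simp only [Matrix.scalar_apply, Matrix.diagonal_apply]
        split_ifs <;> fun_prop
      have hxe : Matrix.scalar (Fin 1) (x 0 0) = x := by
        ext i j
        fin_cases i; fin_cases j
        simp
      rw [← hxe]
      exact map_mem_closure hc hx fun r hr => hr.map (Matrix.scalar (Fin 1))
    have key : Dense {x : Matrix (Fin n ⊕ Fin 1) (Fin n ⊕ Fin 1) R | IsUnit x} := by
      intro x
      rw [← Matrix.fromBlocks_toBlocks x]
      generalize x.toBlocks₁₁ = P, x.toBlocks₁₂ = Q, x.toBlocks₂₁ = S, x.toBlocks₂₂ = d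
      -- Two successive perturbations: the corner `P` becomes a unit `u`, then the Schur complement
      -- `d - S u⁻¹ Q` becomes a unit `e`. The resulting matrix has an invertible `LDU`
      -- factorisation.
      rw [← closure_closure]
      refine map_mem_closure (f := fun P => fromBlocks P Q S d)
        (continuous_id.matrix_fromBlocks continuous_const continuous_const continuous_const)
        (ih P) ?_
      rintro _ ⟨u, rfl⟩
      set u' : Matrix (Fin n) (Fin n) R := ↑u⁻¹ with hu'
      rw [← sub_add_cancel d (S * u' * Q)]
      refine map_mem_closure
        (f := fun e => fromBlocks (u : Matrix (Fin n) (Fin n) R) Q S (e + S * u' * Q))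
        (continuous_const.matrix_fromBlocks continuous_const continuous_const
          (continuous_id.add continuous_const)) (h1 _) ?_
      rintro _ ⟨e, rfl⟩
      have hL : IsUnit (fromBlocks (1 : Matrix (Fin n) (Fin n) R) 0 (S * u')
          (1 : Matrix (Fin 1) (Fin 1) R)) := by
        refine isUnit_iff_exists.2 ⟨fromBlocks 1 0 (-(S * u')) 1, ?_, ?_⟩ <;>
          simp [fromBlocks_multiply, hu']
      have hU : IsUnit (fromBlocks (1 : Matrix (Fin n) (Fin n) R) (u' * Q) 0
          (1 : Matrix (Fin 1) (Fin 1) R)) := by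
        refine isUnit_iff_exists.2 ⟨fromBlocks 1 (-(u' * Q)) 0 1, ?_, ?_⟩ <;>
          simp [fromBlocks_multiply, hu']
      have hD : IsUnit (fromBlocks (u : Matrix (Fin n) (Fin n) R) 0 0
          (e : Matrix (Fin 1) (Fin 1) R)) := by
        refine isUnit_iff_exists.2 ⟨fromBlocks u' 0 0 (↑e⁻¹ : Matrix (Fin 1) (Fin 1) R), ?_, ?_⟩ <;>
          simp [fromBlocks_multiply, hu']
      have := (hL.mul hD).mul hU
      convert this using 1
      simp [fromBlocks_multiply, hu', Matrix.mul_assoc,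
        ← Matrix.mul_assoc (u : Matrix (Fin n) (Fin n) R), add_comm]
    intro x
    let E := Matrix.reindexRingEquiv R (finSumFinEquiv (m := n) (n := 1))
    have hE : Continuous E := Continuous.matrix_reindex continuous_id _ _
    rw [← E.apply_symm_apply x]
    exact map_mem_closure hE (key _) fun y hy => hy.map E

end StableRank

/-! ### Rectangular matrices and Cuntz comparison. -/

section Rect

set_option linter.unusedSectionVars false

variable {A : Type*} [CStarAlgebra A] [PartialOrder A] [StarOrderedRing A] {k l m n : ℕ}

theorem dense_isUnit_cstarMatrix (h : Dense {x : A | IsUnit x}) (n : ℕ) :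
    Dense {x : CStarMatrix (Fin n) (Fin n) A | IsUnit x} :=
  dense_isUnit_matrix h n

theorem rect_mul_assoc (x : CStarMatrix (Fin k) (Fin l) A) (y : CStarMatrix (Fin l) (Fin m) A)
    (z : CStarMatrix (Fin m) (Fin n) A) : x * y * z = x * (y * z) :=
  Matrix.mul_assoc (l := Fin k) (m := Fin l) (n := Fin m) (o := Fin n) x y z

/-- The ring multiplication of square matrices is the multiplication of rectangular ones. -/
theorem ring_mul_eq_rect_mul (x y : CStarMatrix (Fin n) (Fin n) A) :
    @HMul.hMul _ _ _ instHMul x y = x * y := rfl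

theorem rect_conjTranspose_mul (x : CStarMatrix (Fin k) (Fin l) A)
    (y : CStarMatrix (Fin l) (Fin m) A) :
    (x * y).conjTranspose = y.conjTranspose * x.conjTranspose :=
  Matrix.conjTranspose_mul (m := Fin k) (n := Fin l) (l := Fin m) x y

theorem rect_conjTranspose_conjTranspose (x : CStarMatrix (Fin k) (Fin l) A) :
    x.conjTranspose.conjTranspose = x :=
  Matrix.conjTranspose_conjTranspose (m := Fin k) (n := Fin l) x

theorem rect_one_mul (x : CStarMatrix (Fin k) (Fin l) A) :
    (1 : CStarMatrix (Fin k) (Fin k) A) * x = x :=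
  Matrix.one_mul (m := Fin k) (n := Fin l) x

theorem rect_mul_one (x : CStarMatrix (Fin k) (Fin l) A) :
    x * (1 : CStarMatrix (Fin l) (Fin l) A) = x :=
  Matrix.mul_one (m := Fin k) (n := Fin l) x

theorem rect_continuous_mul {X : Type*} [TopologicalSpace X]
    {f : X → CStarMatrix (Fin k) (Fin l) A} {g : X → CStarMatrix (Fin l) (Fin m) A}
    (hf : Continuous f) (hg : Continuous g) : Continuous fun x => f x * g x :=
  Continuous.matrix_mul (m := Fin k) (n := Fin l) (p := Fin m) (A := f) (B := g) hf hg

theorem continuous_conj (v : CStarMatrix (Fin k) (Fin l) A) :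
    Continuous fun x : CStarMatrix (Fin l) (Fin l) A => v * x * v.conjTranspose :=
  rect_continuous_mul (rect_continuous_mul continuous_const continuous_id) continuous_const

theorem rect_sum_apply {ι : Type*} (s : Finset ι) (f : ι → CStarMatrix (Fin k) (Fin l) A)
    (i : Fin k) (j : Fin l) : (∑ p ∈ s, f p) i j = ∑ p ∈ s, f p i j :=
  Matrix.sum_apply (m := Fin k) (n := Fin l) i j s f

/-- Placing each column of `x` as column `0` of a square matrix `y p` gives `x x⋆ = ∑ y p (y p)⋆`.
The case `k = 0` is separate because column `0` must exist. -/
theorem mul_conjTranspose_self_nonneg (x : CStarMatrix (Fin k) (Fin l) A) :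
    0 ≤ x * x.conjTranspose := by
  rcases k with _ | k
  · exact le_of_eq (CStarMatrix.ext fun i => i.elim0)
  let y : Fin l → CStarMatrix (Fin (k + 1)) (Fin (k + 1)) A := fun p =>
    CStarMatrix.ofMatrix fun i j => if j = 0 then x i p else 0
  have hy : ∀ p i j, y p i j = if j = 0 then x i p else 0 := fun _ _ _ => rfl
  have h : x * x.conjTranspose = ∑ p : Fin l, y p * star (y p) := by
    ext i j
    rw [rect_sum_apply, CStarMatrix.mul_apply]
    refine Finset.sum_congr rfl fun p _ => ?_
    rw [CStarMatrix.mul_apply, Finset.sum_eq_single 0]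
    · simp [hy, CStarMatrix.star_apply, CStarMatrix.conjTranspose_apply]
    · intro q _ hq
      simp [hy, hq]
    · simp
  rw [h]
  exact Finset.sum_nonneg fun p _ => mul_star_self_nonneg _

/-- Cuntz subequivalence of square matrices, with no positivity required. -/
def Dom (x : CStarMatrix (Fin k) (Fin k) A) (y : CStarMatrix (Fin l) (Fin l) A) : Prop :=
  x ∈ closure (Set.range fun v : CStarMatrix (Fin k) (Fin l) A => v * y * v.conjTranspose)

theorem Dom.trans {x : CStarMatrix (Fin k) (Fin k) A} {y : CStarMatrix (Fin l) (Fin l) A}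
    {z : CStarMatrix (Fin m) (Fin m) A} (hxy : Dom x y) (hyz : Dom y z) : Dom x z := by
  refine closure_minimal ?_ isClosed_closure hxy
  rintro _ ⟨v, rfl⟩
  refine map_mem_closure (f := fun x => v * x * v.conjTranspose) (continuous_conj v) hyz ?_
  rintro _ ⟨w, rfl⟩
  exact ⟨v * w, by simp only [rect_conjTranspose_mul, rect_mul_assoc]⟩

theorem dom_conj (v : CStarMatrix (Fin k) (Fin l) A) (y : CStarMatrix (Fin l) (Fin l) A) :
    Dom (v * y * v.conjTranspose) y := subset_closure ⟨v, rfl⟩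

theorem isClosed_dom (y : CStarMatrix (Fin l) (Fin l) A) :
    IsClosed {x : CStarMatrix (Fin k) (Fin k) A | Dom x y} := isClosed_closure

theorem rect_inverse_mul_cancel {u : CStarMatrix (Fin k) (Fin k) A} (hu : IsUnit u) :
    Ring.inverse u * u = 1 := Ring.inverse_mul_cancel u hu

theorem rect_mul_inverse_cancel {u : CStarMatrix (Fin k) (Fin k) A} (hu : IsUnit u) :
    u * Ring.inverse u = 1 := Ring.mul_inverse_cancel u hu

theorem rect_mul_algebraMap (x : CStarMatrix (Fin k) (Fin l) A) (δ : ℝ) :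
    x * algebraMap ℝ (CStarMatrix (Fin l) (Fin l) A) δ = δ • x := by
  rw [Algebra.algebraMap_eq_smul_one, CStarMatrix.mul_smul, rect_mul_one]

theorem rect_algebraMap_mul (x : CStarMatrix (Fin k) (Fin l) A) (δ : ℝ) :
    algebraMap ℝ (CStarMatrix (Fin k) (Fin k) A) δ * x = δ • x := by
  rw [Algebra.algebraMap_eq_smul_one, CStarMatrix.smul_mul, rect_one_mul]

theorem conjTranspose_mul_self_nonneg (x : CStarMatrix (Fin k) (Fin l) A) :
    0 ≤ x.conjTranspose * x := by
  simpa only [rect_conjTranspose_conjTranspose] using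
    mul_conjTranspose_self_nonneg x.conjTranspose

/-- The push-through identity, from `x(x⋆x + δ) = (xx⋆ + δ)x`. It relates matrix algebras of
different sizes by pure algebra, which is the advantage of using resolvents. -/
theorem inverse_mul_rect (x : CStarMatrix (Fin k) (Fin l) A) {δ : ℝ} (hδ : 0 < δ) :
    Ring.inverse (x * x.conjTranspose + algebraMap ℝ _ δ) * x =
      x * Ring.inverse (x.conjTranspose * x + algebraMap ℝ _ δ) := by
  have h1 : IsUnit (x * x.conjTranspose + algebraMap ℝ _ δ) :=
    (isStrictlyPositive_add_algebraMap (mul_conjTranspose_self_nonneg x) hδ).isUnit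
  have h2 : IsUnit (x.conjTranspose * x + algebraMap ℝ _ δ) :=
    (isStrictlyPositive_add_algebraMap (conjTranspose_mul_self_nonneg x) hδ).isUnit
  have h3 : x * (x.conjTranspose * x + algebraMap ℝ _ δ) =
      (x * x.conjTranspose + algebraMap ℝ _ δ) * x := by
    rw [CStarMatrix.mul_add, CStarMatrix.add_mul, rect_mul_algebraMap, rect_algebraMap_mul,
      rect_mul_assoc]
  calc Ring.inverse (x * x.conjTranspose + algebraMap ℝ _ δ) * x
      = Ring.inverse (x * x.conjTranspose + algebraMap ℝ _ δ) *
          (x * (x.conjTranspose * x + algebraMap ℝ _ δ)) *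
          Ring.inverse (x.conjTranspose * x + algebraMap ℝ _ δ) := by
        rw [rect_mul_assoc, rect_mul_assoc, rect_mul_inverse_cancel h2, rect_mul_one]
    _ = _ := by
        rw [h3, ← rect_mul_assoc, rect_inverse_mul_cancel h1, rect_one_mul]

theorem conjTranspose_mul_inverse_mul (x : CStarMatrix (Fin k) (Fin l) A) {δ : ℝ} (hδ : 0 < δ) :
    x.conjTranspose * Ring.inverse (x * x.conjTranspose + algebraMap ℝ _ δ) * x =
      approxUnit δ (x.conjTranspose * x) := by
  rw [rect_mul_assoc, inverse_mul_rect x hδ, ← rect_mul_assoc]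
  rfl

theorem rect_exists_sqrt {a : CStarMatrix (Fin k) (Fin k) A} (ha : 0 ≤ a) :
    ∃ h : CStarMatrix (Fin k) (Fin k) A, h.conjTranspose = h ∧ h * h = a :=
  exists_sqrt_of_nonneg ha

theorem tendsto_sqrt_mul_approxUnit {a h : CStarMatrix (Fin k) (Fin k) A}
    (hh : h.conjTranspose = h) (ha : h * h = a) :
    Tendsto (fun δ => h * approxUnit δ a) (𝓝[>] 0) (𝓝 h) := by
  have := tendsto_mul_approxUnit h
  rw [CStarMatrix.star_eq_conjTranspose, hh, ring_mul_eq_rect_mul, ha] at this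
  exact this

theorem continuous_conjTranspose :
    Continuous fun x : CStarMatrix (Fin k) (Fin l) A => x.conjTranspose :=
  Continuous.matrix_conjTranspose (m := Fin k) (n := Fin l) continuous_id

/-- `x⋆x ≾ xx⋆`. -/
theorem conjTranspose_mul_self_dom (x : CStarMatrix (Fin k) (Fin l) A) :
    Dom (x.conjTranspose * x) (x * x.conjTranspose) := by
  have hp := conjTranspose_mul_self_nonneg x
  obtain ⟨s, hs, hsp⟩ := rect_exists_sqrt hp
  have h1 := tendsto_sqrt_mul_approxUnit hs hsp
  have hc : Continuous fun y : CStarMatrix (Fin l) (Fin l) A => y * y.conjTranspose :=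
    rect_continuous_mul continuous_id continuous_conjTranspose
  have h2 := (hc.tendsto s).comp h1
  rw [hs, hsp] at h2
  refine mem_closure_of_tendsto h2 ?_
  filter_upwards [self_mem_nhdsWithin] with δ hδ
  have hG : (Ring.inverse (x * x.conjTranspose + algebraMap ℝ _ δ)).conjTranspose =
      Ring.inverse (x * x.conjTranspose + algebraMap ℝ _ δ) :=
    star_inverse_add_algebraMap (mul_conjTranspose_self_nonneg x) hδ
  -- Calling this witness `v`, one has `v x = s e` with `e = approxUnit δ (x⋆x)`, so `v(xx⋆)v⋆ =
  -- (se)(se)⋆`, which tends to `x⋆x`.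
  refine ⟨s * x.conjTranspose * Ring.inverse (x * x.conjTranspose + algebraMap ℝ _ δ), ?_⟩
  simp only [Function.comp]
  rw [← conjTranspose_mul_inverse_mul x hδ]
  simp only [rect_conjTranspose_mul, rect_conjTranspose_conjTranspose, hs, hG, rect_mul_assoc]

end Rect

/-! ### Perturbation in stable rank one and the Baire argument. -/

section Density

set_option linter.unusedSectionVars false

variable {A : Type*} [CStarAlgebra A] [PartialOrder A] [StarOrderedRing A] {k l m n : ℕ}

theorem Dom.exists_norm_lt {x : CStarMatrix (Fin k) (Fin k) A} {y : CStarMatrix (Fin l) (Fin l) A}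
    (h : Dom x y) {ε : ℝ} (hε : 0 < ε) :
    ∃ v : CStarMatrix (Fin k) (Fin l) A, ‖v * y * v.conjTranspose - x‖ < ε := by
  obtain ⟨_, ⟨v, rfl⟩, hv⟩ := Metric.mem_closure_iff.1 h ε hε
  exact ⟨v, by rwa [dist_comm, dist_eq_norm] at hv⟩

/-- `h q (h q)⋆ ≾ h²`. -/
theorem mul_conjTranspose_dom {h : CStarMatrix (Fin k) (Fin k) A} (hh : h.conjTranspose = h)
    (q : CStarMatrix (Fin k) (Fin l) A) : Dom ((h * q) * (h * q).conjTranspose) (h * h) := by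
  have h1 := conjTranspose_mul_self_dom (q.conjTranspose * h)
  have h2 := dom_conj q.conjTranspose (h * h)
  simp only [rect_conjTranspose_mul, rect_conjTranspose_conjTranspose, hh, rect_mul_assoc]
    at h1 h2 ⊢
  exact h1.trans h2

/-- Approximate `a` by `e a e` with `e = h · h(a + δ)⁻¹`, then the inner `a` by `v b v⋆ =
(vc)(vc)⋆`, where `c² = b`. The left factor `h` keeps the approximants below `a`, while `c` gives
them `n` columns. -/
theorem mem_closure_factor {a h : CStarMatrix (Fin k) (Fin k) A} (hh : h.conjTranspose = h)
    (ha : h * h = a) {b : CStarMatrix (Fin n) (Fin n) A} (hb : 0 ≤ b) (hab : Dom a b) :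
    a ∈ closure {y | ∃ q : CStarMatrix (Fin k) (Fin n) A,
      y = (h * q) * (h * q).conjTranspose} := by
  have ha0 : 0 ≤ a := by
    have := mul_conjTranspose_self_nonneg h
    rwa [hh, ha] at this
  obtain ⟨c, hc, hcb⟩ := rect_exists_sqrt hb
  have hc' : Continuous fun y : CStarMatrix (Fin k) (Fin k) A => y.conjTranspose * y :=
    rect_continuous_mul continuous_conjTranspose continuous_id
  have h1 := (hc'.tendsto h).comp (tendsto_sqrt_mul_approxUnit hh ha)
  rw [hh, ha] at h1
  refine isClosed_closure.mem_of_tendsto h1 ?_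
  filter_upwards [self_mem_nhdsWithin] with δ hδ
  have he : approxUnit δ a = h * (h * Ring.inverse (a + algebraMap ℝ _ δ)) := by
    rw [← rect_mul_assoc, ha]; rfl
  have he' : (approxUnit δ a).conjTranspose = approxUnit δ a :=
    star_approxUnit ha0 hδ
  have h2 : (h * approxUnit δ a).conjTranspose * (h * approxUnit δ a) =
      approxUnit δ a * a * (approxUnit δ a).conjTranspose := by
    rw [he', rect_conjTranspose_mul, hh, he', ← ha]
    simp only [rect_mul_assoc]
  simp only [Function.comp]
  rw [h2]
  refine map_mem_closure
    (f := fun x => approxUnit δ a * x * (approxUnit δ a).conjTranspose) (continuous_conj _) hab ?_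
  rintro _ ⟨v, rfl⟩
  refine ⟨h * Ring.inverse (a + algebraMap ℝ _ δ) * (v * c), ?_⟩
  rw [← hcb, he]
  simp only [rect_conjTranspose_mul, hc, rect_mul_assoc]

/-- The elements of `M_n(A)` below `a` which dominate `a` up to `ε`. -/
def approxEquiv (n : ℕ) (a : CStarMatrix (Fin k) (Fin k) A) (ε : ℝ) :
    Set (CStarMatrix (Fin n) (Fin n) A) :=
  {d | 0 ≤ d ∧ Dom d a ∧ ∃ z : CStarMatrix (Fin k) (Fin n) A, ‖z * d * z.conjTranspose - a‖ < ε}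

/-- Replace `u⋆u` by `u⋆u + τ = r²` with `r` invertible. Then `x⋆r²x = (rx)⋆(rx)` is Cuntz
equivalent to `r xx⋆ r`, and so to `xx⋆`. -/
theorem conj_mem_closure_approxEquiv {a : CStarMatrix (Fin k) (Fin k) A} {ε : ℝ}
    {x : CStarMatrix (Fin k) (Fin n) A} (hx : Dom (x * x.conjTranspose) a)
    (hxa : ‖x * x.conjTranspose - a‖ < ε) (u : CStarMatrix (Fin m) (Fin k) A) :
    x.conjTranspose * (u.conjTranspose * u) * x ∈ closure (approxEquiv n a ε) := by
  have hc : Continuous fun τ : ℝ => x.conjTranspose *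
      (u.conjTranspose * u + algebraMap ℝ (CStarMatrix (Fin k) (Fin k) A) τ) * x :=
    rect_continuous_mul (rect_continuous_mul continuous_const
      (continuous_const.add (continuous_algebraMap ℝ (CStarMatrix (Fin k) (Fin k) A))))
      continuous_const
  have ht := (hc.tendsto 0).mono_left (nhdsWithin_le_nhds (s := Set.Ioi 0))
  rw [map_zero, add_zero] at ht
  refine mem_closure_of_tendsto ht ?_
  filter_upwards [self_mem_nhdsWithin] with τ hτ
  obtain ⟨r, g, hr, hrr, hgr⟩ := exists_sqrt_of_isStrictlyPositive
    (isStrictlyPositive_add_algebraMap (conjTranspose_mul_self_nonneg u) hτ)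
  have hr : r.conjTranspose = r := hr
  have hrr : r * r = u.conjTranspose * u + algebraMap ℝ _ τ := hrr
  have hgr : g * r = 1 := hgr
  have hd : x.conjTranspose * (u.conjTranspose * u + algebraMap ℝ _ τ) * x =
      (r * x).conjTranspose * (r * x) := by
    rw [← hrr, rect_conjTranspose_mul, hr]
    simp only [rect_mul_assoc]
  have h1 : Dom (x * x.conjTranspose) ((r * x).conjTranspose * (r * x)) := by
    have h2 := conjTranspose_mul_self_dom (r * x).conjTranspose
    have h3 := dom_conj g ((r * x) * (r * x).conjTranspose)
    rw [rect_conjTranspose_conjTranspose] at h2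
    have h4 : g * ((r * x) * (r * x).conjTranspose) * g.conjTranspose = x * x.conjTranspose := by
      have h5 : g * ((r * x) * (r * x).conjTranspose) * g.conjTranspose =
          ((g * r) * x) * ((g * r) * x).conjTranspose := by
        simp only [rect_conjTranspose_mul, rect_mul_assoc]
      rw [h5, hgr, rect_one_mul]
    rw [h4] at h3
    exact h3.trans h2
  rw [hd]
  refine ⟨conjTranspose_mul_self_nonneg _, ?_, ?_⟩
  · refine (conjTranspose_mul_self_dom (r * x)).trans (Dom.trans ?_ hx)
    have h3 := dom_conj r (x * x.conjTranspose)
    simp only [rect_conjTranspose_mul, rect_mul_assoc] at h3 ⊢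
    exact h3
  -- The strict bound on `‖xx⋆ - a‖` leaves room in `ε` for approximating `xx⋆`.
  · obtain ⟨z, hz⟩ := h1.exists_norm_lt (sub_pos.2 hxa)
    refine ⟨z, ?_⟩
    calc _ ≤ _ := norm_sub_le_norm_sub_add_norm_sub _ (x * x.conjTranspose) _
      _ < ε := by linarith

/-- In stable rank one, if `d ≾ a ≾ b` with `b, d ∈ M_n(A)`, then `d` can be perturbed to an element
of `M_n(A)` below `a` which almost dominates `a`. -/
theorem mem_closure_approxEquiv (hsr : Dense {x : A | IsUnit x})
    {a : CStarMatrix (Fin k) (Fin k) A} (ha : 0 ≤ a) {b : CStarMatrix (Fin n) (Fin n) A}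
    (hb : 0 ≤ b) (hab : Dom a b) {d : CStarMatrix (Fin n) (Fin n) A} (hd : Dom d a) {ε : ℝ}
    (hε : 0 < ε) : d ∈ closure (approxEquiv n a ε) := by
  obtain ⟨h, hh, hha⟩ := rect_exists_sqrt ha
  refine closure_minimal ?_ isClosed_closure hd
  rintro _ ⟨u, rfl⟩
  have h1 : a ∈ closure ({y | ∃ q : CStarMatrix (Fin k) (Fin n) A,
      y = (h * q) * (h * q).conjTranspose} ∩ Metric.ball a ε) :=
    Set.inter_comm _ _ ▸ Metric.isOpen_ball.inter_closure
      ⟨Metric.mem_ball_self hε, mem_closure_factor hh hha hb hab⟩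
  rw [← closure_closure]
  refine map_mem_closure (f := fun x => u * x * u.conjTranspose) (continuous_conj u) h1 ?_
  rintro _ ⟨⟨q, rfl⟩, hq⟩
  rw [mem_ball_iff_norm] at hq
  set x := h * q
  have hxa : Dom (x * x.conjTranspose) a := hha ▸ mul_conjTranspose_dom hh q
  have h2 := mul_star_mem_closure_conj (dense_isUnit_cstarMatrix hsr n) (u * x)
  have h3 : u * (x * x.conjTranspose) * u.conjTranspose = (u * x) * star (u * x) := by
    simp only [CStarMatrix.star_eq_conjTranspose, rect_conjTranspose_mul, rect_mul_assoc]
  show u * (x * x.conjTranspose) * u.conjTranspose ∈ _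
  rw [h3]
  refine closure_minimal ?_ isClosed_closure h2
  rintro _ ⟨w, hw, rfl⟩
  have hw : w.conjTranspose * w = 1 := hw
  -- The isometry is absorbed into `x`: passing to `x w⋆` leaves `x x⋆` unchanged and turns `x⋆u⋆u
  -- x` into its conjugate by `w`.
  have h4 : (x * w.conjTranspose) * (x * w.conjTranspose).conjTranspose = x * x.conjTranspose := by
    rw [rect_conjTranspose_mul, rect_conjTranspose_conjTranspose, rect_mul_assoc,
      ← rect_mul_assoc w.conjTranspose, hw, rect_one_mul]
  have h5 := conj_mem_closure_approxEquiv (x := x * w.conjTranspose) (by rwa [h4])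
    (by rwa [h4]) u
  convert h5 using 1
  simp only [ring_mul_eq_rect_mul, CStarMatrix.star_eq_conjTranspose, rect_conjTranspose_mul,
    rect_conjTranspose_conjTranspose, rect_mul_assoc]

/-- A sequence increasing for `≾` and bounded above has a least upper bound, obtained as a limit of
elements below its terms. -/
theorem exists_dom_limit (hsr : Dense {x : A | IsUnit x}) {size : ℕ → ℕ}
    (a : ∀ j, CStarMatrix (Fin (size j)) (Fin (size j)) A) (ha : ∀ j, 0 ≤ a j)
    (hmono : ∀ i j, i ≤ j → Dom (a i) (a j)) {b : CStarMatrix (Fin n) (Fin n) A} (hb : 0 ≤ b)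
    (hab : ∀ j, Dom (a j) b) :
    ∃ s : CStarMatrix (Fin n) (Fin n) A, 0 ≤ s ∧ (∀ j, Dom (a j) s) ∧
      s ∈ closure {d | 0 ≤ d ∧ ∃ j, Dom d (a j)} := by
  set S : Set (CStarMatrix (Fin n) (Fin n) A) := closure {d | 0 ≤ d ∧ ∃ j, Dom d (a j)}
  have hSc : IsClosed S := isClosed_closure
  have : CompleteSpace S := hSc.isComplete.completeSpace_coe
  let O : ℕ × ℕ → Set S := fun p => {s | ∃ z : CStarMatrix (Fin (size p.1)) (Fin n) A,
    ‖z * s.1 * z.conjTranspose - a p.1‖ < 1 / ((p.2 : ℝ) + 1)}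
  have hO : ∀ p, IsOpen (O p) := fun p => by
    have : O p = ⋃ z : CStarMatrix (Fin (size p.1)) (Fin n) A,
        {s : S | ‖z * s.1 * z.conjTranspose - a p.1‖ < 1 / ((p.2 : ℝ) + 1)} := by
      ext; simp [O]
    rw [this]
    exact isOpen_iUnion fun z => isOpen_lt
      ((((continuous_conj z).comp continuous_subtype_val).sub continuous_const).norm)
      continuous_const
  have hD : ∀ p, Dense (O p) := fun p => by
    rw [Subtype.dense_iff]
    refine closure_minimal ?_ isClosed_closure
    rintro d ⟨hd0, i, hdi⟩
    have hp : (0 : ℝ) < 1 / ((p.2 : ℝ) + 1) := by positivity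
    -- At stage `N`, both `d` and `a p.1` lie below `a N`. Perturbing `d` to almost dominate `a N`
    -- then suffices, since conjugation by `v` carries a neighbourhood of `a N` close to `a p.1`.
    let N := max i p.1
    obtain ⟨v, hv⟩ := (hmono p.1 N (le_max_right _ _)).exists_norm_lt hp
    obtain ⟨ε, hε, hball⟩ := Metric.isOpen_iff.1 (isOpen_lt
      ((continuous_conj v).sub (continuous_const (y := a p.1))).norm
      (continuous_const (y := 1 / ((p.2 : ℝ) + 1)))) (a N) hv
    have hdN := mem_closure_approxEquiv hsr (ha N) hb (hab N)
      (hdi.trans (hmono i N (le_max_left _ _))) hε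
    refine closure_mono ?_ hdN
    rintro d' ⟨hd'0, hd'a, z, hz⟩
    refine ⟨⟨d', subset_closure ⟨hd'0, N, hd'a⟩⟩, ⟨v * z, ?_⟩, rfl⟩
    have := hball (mem_ball_iff_norm.2 hz)
    have h : v * z * d' * (v * z).conjTranspose =
        v * (z * d' * z.conjTranspose) * v.conjTranspose := by
      simp only [rect_conjTranspose_mul, rect_mul_assoc]
    show ‖v * z * d' * (v * z).conjTranspose - a p.1‖ < _
    rw [h]
    exact this
  have : Nonempty S := ⟨⟨0, subset_closure ⟨le_rfl, 0, subset_closure ⟨0, by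
    simp only [CStarMatrix.zero_mul]⟩⟩⟩⟩
  obtain ⟨s, hs⟩ := (dense_iInter_of_isOpen hO hD).nonempty
  rw [Set.mem_iInter] at hs
  refine ⟨s.1, ?_, fun j => ?_, s.2⟩
  · exact closure_minimal (fun d hd => hd.1) isClosed_Ici s.2
  · refine Metric.mem_closure_iff.2 fun ε hε => ?_
    obtain ⟨N, hN⟩ := exists_nat_one_div_lt hε
    obtain ⟨z, hz⟩ := hs (j, N)
    exact ⟨_, ⟨z, rfl⟩, by rw [dist_comm, dist_eq_norm]; exact hz.trans hN⟩

end Density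

/-! ### Dimension functions through resolvents. -/

section Dimension

set_option linter.unusedSectionVars false

variable {A : Type*} [CStarAlgebra A] [PartialOrder A] [StarOrderedRing A] {k l m n : ℕ}

theorem TracialState.trace_apply (τ : TracialState A) (x : CStarMatrix (Fin n) (Fin n) A) :
    τ.trace n x = ∑ i, τ.toPositiveLinearMap (x i i) := rfl

theorem TracialState.continuous_trace (τ : TracialState A) (n : ℕ) : Continuous (τ.trace n) := by
  have h : Continuous τ.toPositiveLinearMap := map_continuous τ.toPositiveLinearMap
  have h2 : Continuous fun x : CStarMatrix (Fin n) (Fin n) A =>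
      ∑ i, τ.toPositiveLinearMap (x i i) :=
    continuous_finsetSum _ fun i _ =>
      h.comp ((continuous_apply (A := fun _ : Fin n => A) i).comp
        (continuous_apply (A := fun _ : Fin n => Fin n → A) i))
  exact h2

theorem TracialState.trace_mul_comm (τ : TracialState A) (x : CStarMatrix (Fin k) (Fin l) A)
    (y : CStarMatrix (Fin l) (Fin k) A) : τ.trace k (x * y) = τ.trace l (y * x) := by
  simp only [TracialState.trace_apply, CStarMatrix.mul_apply, map_sum]
  rw [Finset.sum_comm]
  exact Finset.sum_congr rfl fun j _ => Finset.sum_congr rfl fun i _ => τ.map_mul_comm _ _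

theorem TracialState.trace_mono (τ : TracialState A) {x y : CStarMatrix (Fin n) (Fin n) A}
    (h : x ≤ y) : (τ.trace n x).re ≤ (τ.trace n y).re := by
  have h1 := (Complex.le_def.1 (τ.trace_nonneg _ (sub_nonneg.2 h))).1
  rw [map_sub] at h1
  simpa using h1

theorem TracialState.trace_approxUnit_comm (τ : TracialState A)
    (x : CStarMatrix (Fin k) (Fin l) A) {δ : ℝ} (hδ : 0 < δ) :
    τ.trace k (approxUnit δ (x * x.conjTranspose)) =
      τ.trace l (approxUnit δ (x.conjTranspose * x)) := by
  rw [← conjTranspose_mul_inverse_mul x hδ, ← TracialState.trace_mul_comm, ← rect_mul_assoc]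
  rfl

theorem isLUB_dimFun (τ : TracialState A) (a : MInftyPos A) :
    IsLUB ((fun δ : ℝ => (τ.trace a.size (approxUnit δ a.mat)).re) '' Set.Ioi 0) (dimFun τ a) :=
  isLUB_of_tendsto_root _ τ.trace_nonneg a.nonneg (tendsto_dimFun τ a)

/-- With `c² = b`, the trace property exchanges `(vc)(vc)⋆` for `c(v⋆v)c`, which is dominated by a
multiple of `b`. -/
theorem TracialState.trace_approxUnit_conj_le (τ : TracialState A) (b : MInftyPos A)
    (v : CStarMatrix (Fin k) (Fin b.size) A) {δ : ℝ} (hδ : 0 < δ) :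
    (τ.trace k (approxUnit δ (v * b.mat * v.conjTranspose))).re ≤ dimFun τ b := by
  obtain ⟨c, hc, hcb⟩ := rect_exists_sqrt b.nonneg
  have h1 : v * b.mat * v.conjTranspose = (v * c) * (v * c).conjTranspose := by
    rw [← hcb, rect_conjTranspose_mul, hc]
    simp only [rect_mul_assoc]
  obtain ⟨C, hC, hle⟩ := exists_approxUnit_conj_le hc hcb (conjTranspose_mul_self_nonneg v)
  have h2 : (v * c).conjTranspose * (v * c) = c * (v.conjTranspose * v) * c := by
    rw [rect_conjTranspose_mul, hc]
    simp only [rect_mul_assoc]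
  rw [h1, τ.trace_approxUnit_comm _ hδ, h2]
  exact (τ.trace_mono (hle δ hδ)).trans ((isLUB_dimFun τ b).1 ⟨δ / C, div_pos hδ hC, rfl⟩)

/-- Lower semicontinuity of the dimension function. -/
theorem dimFun_le_of_mem_closure (τ : TracialState A) (s : MInftyPos A) {D : ℝ}
    {T : Set (CStarMatrix (Fin s.size) (Fin s.size) A)} (hs : s.mat ∈ closure T)
    (hT : ∀ x ∈ T, ∀ δ : ℝ, 0 < δ → (τ.trace s.size (approxUnit δ x)).re ≤ D) :
    dimFun τ s ≤ D := by
  refine (isLUB_dimFun τ s).2 ?_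
  rintro _ ⟨δ, hδ, rfl⟩
  have hc : ContinuousAt (fun x => (τ.trace s.size (approxUnit δ x)).re) s.mat :=
    (Complex.continuous_re.comp (τ.continuous_trace s.size)).continuousAt.comp
      (continuousAt_approxUnit s.nonneg hδ)
  have h := mem_closure_image hc hs
  refine closure_minimal ?_ (isClosed_Iic (a := D)) h
  rintro _ ⟨x, hx, rfl⟩
  exact hT x hx δ hδ

theorem dimFun_mono (τ : TracialState A) {a b : MInftyPos A} (h : CuntzSubequiv a b) :
    dimFun τ a ≤ dimFun τ b := by
  refine dimFun_le_of_mem_closure τ a (cuntzSubequiv_iff_mem_closure.1 h) ?_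
  rintro _ ⟨v, rfl⟩ δ hδ
  exact τ.trace_approxUnit_conj_le b v hδ

end Dimension
end CuntzSemigroup

theorem mainTheorem4 {A : Type*} [CStarAlgebra A] [PartialOrder A] [StarOrderedRing A]
    [TopologicalSpace.SeparableSpace A] (hsr : Dense {x : A | IsUnit x})
    (a : ℕ → CuntzSemigroup.MInftyPos A)
    (hmono : Monotone fun n => CuntzSemigroup.cls (a n))
    (hbdd : BddAbove (Set.range fun n => CuntzSemigroup.cls (a n))) :
    (∃ s : CuntzSemigroup.MInftyPos A,
      IsLUB (Set.range fun n => CuntzSemigroup.cls (a n)) (CuntzSemigroup.cls s)) ∧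
    ∀ s : CuntzSemigroup.MInftyPos A,
      IsLUB (Set.range fun n => CuntzSemigroup.cls (a n)) (CuntzSemigroup.cls s) →
      ∀ τ : CuntzSemigroup.TracialState A,
        IsLUB (Set.range fun n => CuntzSemigroup.dimFun τ (a n)) (CuntzSemigroup.dimFun τ s) := by
  open CuntzSemigroup in
  obtain ⟨b, hb⟩ := hbdd
  induction b using Antisymmetrization.ind with | _ b => ?_
  have hab : ∀ j, CuntzSubequiv (a j) b := fun j => cls_le_cls.1 (hb ⟨j, rfl⟩)
  obtain ⟨t, ht0, hat, htc⟩ := exists_dom_limit hsr (fun j => (a j).mat) (fun j => (a j).nonneg)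
    (fun i j hij => cuntzSubequiv_iff_mem_closure.1 (cls_le_cls.1 (hmono hij))) b.nonneg
    (fun j => cuntzSubequiv_iff_mem_closure.1 (hab j))
  let t' : MInftyPos A := ⟨b.size, t, ht0⟩
  have hlub : IsLUB (Set.range fun n => cls (a n)) (cls t') := by
    constructor
    · rintro _ ⟨j, rfl⟩
      exact cls_le_cls.2 (cuntzSubequiv_iff_mem_closure.2 (hat j))
    · intro c hc
      induction c using Antisymmetrization.ind with | _ c => ?_
      refine cls_le_cls.2 (cuntzSubequiv_iff_mem_closure.2 ?_)
      refine closure_minimal ?_ (isClosed_dom c.mat) htc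
      rintro d ⟨-, j, hj⟩
      exact hj.trans (cuntzSubequiv_iff_mem_closure.1 (cls_le_cls.1 (hc ⟨j, rfl⟩)))
  refine ⟨⟨t', hlub⟩, fun s hs τ => ⟨?_, fun D hD => ?_⟩⟩
  · rintro _ ⟨j, rfl⟩
    exact dimFun_mono τ (cls_le_cls.1 (hs.1 ⟨j, rfl⟩))
  -- Any representative `s` of the supremum lies below the constructed `t'`, so the upper estimate
  -- is needed only for `t'`, where membership in the closure is available.
  · refine (dimFun_mono τ (cls_le_cls.1 (hs.2 hlub.1))).trans ?_
    refine dimFun_le_of_mem_closure τ t' htc ?_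
    rintro d ⟨hd0, j, hj⟩ δ hδ
    let d' : MInftyPos A := ⟨b.size, d, hd0⟩
    have h1 : (τ.trace b.size (approxUnit δ d)).re ≤ dimFun τ d' :=
      (isLUB_dimFun τ d').1 ⟨δ, hδ, rfl⟩
    exact h1.trans ((dimFun_mono τ (a := d') (b := a j)
      (cuntzSubequiv_iff_mem_closure.2 hj)).trans (hD ⟨j, rfl⟩))
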